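/- Let $k$ be an algebraically closed field and let $\mathcal{C}$ be a $k$-linear triangulated category with split idempotents and suspension functor $\Sigma$. Assume that $\mathcal{C}$ is Hom-finite (all $\mathcal{C}(X,Y)$ are finite-dimensional over $k$) and 2-Calabi--Yau (there are bifunctorial $k$-linear isomorphisms $\mathcal{C}(X,\Sigma Y)\simeq \operatorname{Hom}_k(\mathcal{C}(Y,\Sigma X),k)$). Let $T$ be a cluster-tilting object of $\mathcal{C}$: $\mathcal{C}(T,\Sigma T)=0$, and every $X$ with $\mathcal{C}(X,\Sigma T)=0$ belongs to $\operatorname{add}T$, the full subcategory of direct summands of finite direct sums of copies of $T$. Let $F=\mathcal{C}(T,?)$, a functor from $\mathcal{C}$ to finite-dimensional right $\operatorname{End}_{\mathcal{C}}(T)$-modules. For an object $Y$, write $(Y)$ for the ideal of morphisms of $\mathcal{C}$ that factor through a finite direct sum of copies of $Y$. For a triangle $M\xrightarrow{i}B\xrightarrow{p}L\xrightarrow{\varepsilon}\Sigma M$ and morphisms $i_U:U\to M$, $i_V:V\to L$ such that $Fi_U$ and $Fi_V$ are monomorphisms (so that $FU$ and $FV$ are identified with submodules of $FM$ and $FL$),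 consider the conditions: (i) there is a submodule $E\subset FB$ such that $FV=(Fp)E$ and $FU=(Fi)^{-1}E$; (ii) there are morphisms $e:\Sigma^{-1}V\to U$ and $f:\Sigma^{-1}L\to U$ such that (a) $(\Sigma^{-1}\varepsilon)(\Sigma^{-1}i_V)=i_U e$, (b) $e\in(T)$, and (c) $i_U f-\Sigma^{-1}\varepsilon\in(\Sigma T)$; (iii) there are $e$ and $f$ as in (ii) which moreover satisfy $e=f\,\Sigma^{-1}i_V$. Now let $L,M\in\mathcal{C}$ be such that $\dim_k\mathcal{C}(L,\Sigma M)=1$, let $$\Delta: M\xrightarrow{i}B\xrightarrow{p}L\xrightarrow{\varepsilon}\Sigma M\quad\text{and}\quad \Delta': L\xrightarrow{i'}B'\xrightarrow{p'}M\xrightarrow{\varepsilon'}\Sigma L$$ be non-split triangles (i.e. $\varepsilon\neq0$ and $\varepsilon'\neq0$), and let $i_U:U\to M$ and $i_V:V\to L$ be morphisms whose images under $F$ are monomorphisms. Then conditions (i), (ii), (iii) for $\Delta$ and the pair $(i_U,i_V)$ are equivalent to each other, conditions (i), (ii), (iii) for $\Delta'$ and the pair $(i_V,i_U)$ (that is,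 with the roles of $M,U$ and of $L,V$ exchanged) are equivalent to each other, and each of these conditions holds for $\Delta$ if and only if it does not hold for $\Delta'$. -/

import Mathlib

open CategoryTheory Limits Pretriangulated

universe w v u

noncomputable section

namespace TwoCY

/-- `𝒞` is 2-Calabi–Yau over `k`: there are `k`-linear isomorphisms
`𝒞(X, ΣY) ≃ D 𝒞(Y, ΣX)`, with `D = Hom_k(?, k)`, natural in `X` and in `Y`. -/
def IsTwoCalabiYau (k : Type w) [Field k] (C : Type u) [Category.{v} C] [Preadditive C]
    [Linear k C] [HasShift C ℤ] : Prop :=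
  ∃ φ : ∀ X Y : C, (X ⟶ Y⟦(1 : ℤ)⟧) ≃ₗ[k] Module.Dual k (Y ⟶ X⟦(1 : ℤ)⟧),
    ∀ (X X' Y Y' : C) (f : X' ⟶ X) (g : Y ⟶ Y') (a : X ⟶ Y⟦(1 : ℤ)⟧) (b : Y' ⟶ X'⟦(1 : ℤ)⟧),
      φ X' Y' (f ≫ a ≫ g⟦(1 : ℤ)⟧') b = φ X Y a (g ≫ b ≫ f⟦(1 : ℤ)⟧')

section

variable {C : Type u} [Category.{v} C] [Preadditive C] [HasFiniteBiproducts C]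

/-- `X` lies in `add T`: it is a direct summand of a finite direct sum of copies of `T`. -/
def InAdd (T X : C) : Prop :=
  ∃ n : ℕ, Nonempty (Retract X (⨁ fun _ : Fin n => T))

/-- `f` belongs to the ideal `(T)` of morphisms that factor through a finite direct sum of
copies of `T`. -/
def InIdeal (T : C) {X Y : C} (f : X ⟶ Y) : Prop :=
  ∃ (n : ℕ) (a : X ⟶ ⨁ fun _ : Fin n => T) (b : (⨁ fun _ : Fin n => T) ⟶ Y), f = a ≫ b

/-- `T` is a cluster-tilting object: `𝒞(T, ΣT) = 0`, and `𝒞(X, ΣT) = 0` implies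
`X ∈ add T`. -/
structure IsClusterTilting [HasShift C ℤ] (T : C) : Prop where
  rigid : ∀ f : T ⟶ T⟦(1 : ℤ)⟧, f = 0
  mem_add : ∀ X : C, (∀ f : X ⟶ T⟦(1 : ℤ)⟧, f = 0) → InAdd T X

end

section

variable {C : Type u} [Category.{v} C] [Preadditive C]

/-- The functor `F = 𝒞(T, ?)` to right modules over `End T`, that is, to modules over
`(End T)ᵐᵒᵖ`, the endomorphisms of `T` acting by precomposition. -/
abbrev F (T : C) : C ⥤ ModuleCat.{v} (End T)ᵐᵒᵖ :=
  preadditiveCoyonedaObj T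

/-- Condition (i) on the sequence `M ⟶ B ⟶ L` (with maps `i`, `p`) and on `iU : U ⟶ M`,
`iV : V ⟶ L`: there is a submodule `E` of `FB` with `FV = (Fp)E` and `FU = (Fi)⁻¹E`, where `FU`
and `FV` are identified with their images in `FM` and `FL`. -/
def CondI (T : C) {M B L U V : C} (i : M ⟶ B) (p : B ⟶ L) (iU : U ⟶ M) (iV : V ⟶ L) : Prop :=
  ∃ E : Submodule (End T)ᵐᵒᵖ ((F T).obj B),
    LinearMap.range ((F T).map iV).hom = E.map ((F T).map p).hom ∧
      LinearMap.range ((F T).map iU).hom = E.comap ((F T).map i).hom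

variable [HasShift C ℤ]

/-- The morphism `Σ⁻¹ε : Σ⁻¹L ⟶ M` obtained from `ε : L ⟶ ΣM`, through the canonical
isomorphism `Σ⁻¹ΣM ≅ M`. -/
def desusp {L M : C} (ε : L ⟶ M⟦(1 : ℤ)⟧) : L⟦(-1 : ℤ)⟧ ⟶ M :=
  ε⟦(-1 : ℤ)⟧' ≫ (shiftShiftNeg M (1 : ℤ)).hom

variable [HasFiniteBiproducts C]

/-- The requirements (a), (b), (c) on a pair of morphisms `e : Σ⁻¹V ⟶ U` and `f : Σ⁻¹L ⟶ U`. -/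
structure IsFactorization (T : C) {M L U V : C} (ε : L ⟶ M⟦(1 : ℤ)⟧) (iU : U ⟶ M) (iV : V ⟶ L)
    (e : V⟦(-1 : ℤ)⟧ ⟶ U) (f : L⟦(-1 : ℤ)⟧ ⟶ U) : Prop where
  comm : iV⟦(-1 : ℤ)⟧' ≫ desusp ε = e ≫ iU
  e_mem : InIdeal T e
  f_mem : InIdeal (T⟦(1 : ℤ)⟧) (f ≫ iU - desusp ε)

/-- Condition (ii). -/
def CondII (T : C) {M L U V : C} (ε : L ⟶ M⟦(1 : ℤ)⟧) (iU : U ⟶ M) (iV : V ⟶ L) : Prop :=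
  ∃ (e : V⟦(-1 : ℤ)⟧ ⟶ U) (f : L⟦(-1 : ℤ)⟧ ⟶ U), IsFactorization T ε iU iV e f

/-- Condition (iii): condition (ii) where, moreover, `e = f ∘ Σ⁻¹iV`. -/
def CondIII (T : C) {M L U V : C} (ε : L ⟶ M⟦(1 : ℤ)⟧) (iU : U ⟶ M) (iV : V ⟶ L) : Prop :=
  ∃ (e : V⟦(-1 : ℤ)⟧ ⟶ U) (f : L⟦(-1 : ℤ)⟧ ⟶ U),
    IsFactorization T ε iU iV e f ∧ e = iV⟦(-1 : ℤ)⟧' ≫ f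

end

end TwoCY

end

/-! Regarding `e` and `f` as morphisms into `ΣU`, membership in the ideals `(T)` and `(ΣT)` becomes
being killed by `𝒞(T, ?)` and by `𝒞(ΣT, ?)`, because every object is the cone of a morphism in
`add T`. The implication (i) ⇒ (ii) lifts through projective presentations over `End T`,
(ii) ⇒ (iii) corrects `f` by a morphism extended along `iV`, which exists by Calabi–Yau duality,
and for (ii) ⇒ (i) the submodule `E` is the image of the fibre of `e`.

For the dichotomy, fix `iU` and `iV`. The `ε ∈ 𝒞(L, ΣM)` satisfying (iii) and the
`ε' ∈ 𝒞(M, ΣL)` satisfying (ii) with the roles exchanged form subspaces. Under the Calabi–Yau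
pairing the morphisms killed by `𝒞(S, ?)`, for `S = T` or `S = ΣT`, are the orthogonal complement
of the morphisms of the same kind, and composition with a morphism on one side is adjoint to
composition on the other; so the two subspaces are orthogonal complements of each other. As both
spaces are one-dimensional, exactly one of the two subspaces is nonzero.
-/

namespace TwoCY

section Orthogonal

variable {k : Type*} [Field k] {A B A' B' : Type*} [AddCommGroup A] [Module k A]
  [AddCommGroup B] [Module k B] [AddCommGroup A'] [Module k A'] [AddCommGroup B'] [Module k B']

lemma mem_map_sup {f : A →ₗ[k] B} {W : Submodule k A} {N : Submodule k B} {b : B} :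
    b ∈ W.map f ⊔ N ↔ ∃ a ∈ W, f a - b ∈ N := by
  rw [sup_comm, Submodule.mem_sup]
  constructor
  · rintro ⟨n, hn, _, ⟨a, ha, rfl⟩, rfl⟩
    exact ⟨a, ha, by rwa [sub_add_cancel_right, neg_mem_iff]⟩
  · rintro ⟨a, ha, hn⟩
    exact ⟨_, neg_mem hn, f a, ⟨a, ha, rfl⟩, by rw [neg_sub, sub_add_cancel]⟩

lemma dualAnnihilator_comap (f : B →ₗ[k] B') (W : Submodule k B') :
    (W.comap f).dualAnnihilator = W.dualAnnihilator.map f.dualMap := by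
  rw [← W.range_dualMap_mkQ_eq, ← LinearMap.range_comp, LinearMap.dualMap_comp_dualMap,
    LinearMap.range_dualMap_eq_dualAnnihilator_ker, LinearMap.ker_comp, Submodule.ker_mkQ]

/-- The subspace of `A` orthogonal to `W ⊆ B` with respect to the pairing `A × B → k` given by
the isomorphism `φ : A ≃ Hom_k(B, k)`. -/
def orthogonal (φ : A ≃ₗ[k] Module.Dual k B) (W : Submodule k B) : Submodule k A :=
  W.dualAnnihilator.comap (φ : A →ₗ[k] Module.Dual k B)

lemma mem_orthogonal {φ : A ≃ₗ[k] Module.Dual k B} {W : Submodule k B} {a : A} :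
    a ∈ orthogonal φ W ↔ ∀ b ∈ W, φ a b = 0 :=
  Submodule.mem_dualAnnihilator _

lemma orthogonal_bot (φ : A ≃ₗ[k] Module.Dual k B) : orthogonal φ ⊥ = ⊤ := by
  rw [orthogonal, Submodule.dualAnnihilator_bot, Submodule.comap_top]

lemma orthogonal_top (φ : A ≃ₗ[k] Module.Dual k B) : orthogonal φ ⊤ = ⊥ := by
  rw [orthogonal, Submodule.dualAnnihilator_top, Submodule.comap_bot, LinearEquiv.ker]

lemma orthogonal_sup (φ : A ≃ₗ[k] Module.Dual k B) (W W' : Submodule k B) :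
    orthogonal φ (W ⊔ W') = orthogonal φ W ⊓ orthogonal φ W' := by
  rw [orthogonal, Submodule.dualAnnihilator_sup_eq, Submodule.comap_inf, orthogonal, orthogonal]

lemma orthogonal_inf (φ : A ≃ₗ[k] Module.Dual k B) (W W' : Submodule k B) :
    orthogonal φ (W ⊓ W') = orthogonal φ W ⊔ orthogonal φ W' := by
  simp only [orthogonal, Subspace.dualAnnihilator_inf_eq, Submodule.comap_equiv_eq_map_symm,
    Submodule.map_sup]

variable {φ : A ≃ₗ[k] Module.Dual k B} {φ' : A' ≃ₗ[k] Module.Dual k B'}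

lemma orthogonal_map {f : B →ₗ[k] B'} {f' : A' →ₗ[k] A}
    (hf : ∀ a b, φ (f' a) b = φ' a (f b)) (W : Submodule k B) :
    orthogonal φ' (W.map f) = (orthogonal φ W).comap f' := by
  ext a
  simp only [mem_orthogonal, Submodule.mem_comap, Submodule.mem_map, forall_exists_index, and_imp,
    forall_apply_eq_imp_iff₂, hf]

lemma orthogonal_comap {f : B →ₗ[k] B'} {f' : A' →ₗ[k] A}
    (hf : ∀ a b, φ (f' a) b = φ' a (f b)) (W : Submodule k B') :
    orthogonal φ (W.comap f) = (orthogonal φ' W).map f' := by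
  have hf' : f.dualMap ∘ₗ φ' = (φ : A →ₗ[k] Module.Dual k B) ∘ₗ f' := by
    ext a b
    exact (hf a b).symm
  have hW : W.dualAnnihilator = (orthogonal φ' W).map (φ' : A' →ₗ[k] Module.Dual k B') :=
    (Submodule.map_comap_eq_of_surjective φ'.surjective _).symm
  rw [orthogonal, dualAnnihilator_comap, hW, ← Submodule.map_comp, hf', Submodule.map_comp,
    Submodule.comap_map_eq_of_injective φ.injective]

lemma orthogonal_ker {f : B →ₗ[k] B'} {f' : A' →ₗ[k] A}
    (hf : ∀ a b, φ (f' a) b = φ' a (f b)) :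
    orthogonal φ (LinearMap.ker f) = LinearMap.range f' := by
  rw [← Submodule.comap_bot, orthogonal_comap hf, orthogonal_bot, Submodule.map_top]

lemma mem_orthogonal_iff_notMem (hdim : Module.finrank k B = 1) {a : A} (ha : a ≠ 0) {b : B}
    (hb : b ≠ 0) (W : Submodule k B) : a ∈ orthogonal φ W ↔ b ∉ W := by
  have := isSimpleModule_iff_finrank_eq_one.2 hdim
  obtain rfl | rfl := eq_bot_or_eq_top W
  · simp only [orthogonal_bot, Submodule.mem_top, Submodule.mem_bot, hb, not_false_eq_true]
  · simp only [orthogonal_top, Submodule.mem_top, Submodule.mem_bot, ha, not_true_eq_false]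

lemma finite_of_mutually_dual (e : A ≃ₗ[k] Module.Dual k B) (e' : B ≃ₗ[k] Module.Dual k A) :
    Module.Finite k A := by
  have : Module.Finite k (A × B) := Basis.linearEquiv_dual_iff_finiteDimensional.1
    ⟨e.prodCongr e' ≪≫ₗ LinearEquiv.prodComm k _ _ ≪≫ₗ Module.dualProdDualEquivDual k A B⟩
  exact Module.Finite.of_surjective (LinearMap.fst k A B) LinearMap.fst_surjective

end Orthogonal

section Relative

variable {C : Type u} [Category.{v} C] [Preadditive C]

/-- `f` is an `S`-ghost: `𝒞(S, f) = 0`. -/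
def IsGhost (S : C) {X Y : C} (f : X ⟶ Y) : Prop :=
  ∀ t : S ⟶ X, t ≫ f = 0

lemma IsGhost.precomp {S X Y Z : C} {f : Y ⟶ Z} (hf : IsGhost S f) (g : X ⟶ Y) :
    IsGhost S (g ≫ f) := fun t => by
  rw [← Category.assoc, hf]

lemma IsGhost.postcomp {S X Y Z : C} {f : X ⟶ Y} (hf : IsGhost S f) (g : Y ⟶ Z) :
    IsGhost S (f ≫ g) := fun t => by
  rw [← Category.assoc, hf, zero_comp]

/-- `j` is `S`-monic: `𝒞(S, j)` is injective. -/
def IsMonic (S : C) {X Y : C} (j : X ⟶ Y) : Prop :=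
  ∀ u : S ⟶ X, u ≫ j = 0 → u = 0

lemma mono_F_map_iff_isMonic {S X Y : C} (j : X ⟶ Y) : Mono ((F S).map j) ↔ IsMonic S j := by
  rw [ModuleCat.mono_iff_injective]
  exact injective_iff_map_eq_zero _

lemma IsMonic.isGhost_of_comp {S X Y Z : C} {j : Y ⟶ Z} (hj : IsMonic S j) {f : X ⟶ Y}
    (hf : IsGhost S (f ≫ j)) : IsGhost S f := fun t =>
  hj _ (by rw [Category.assoc, hf])

lemma IsMonic.shift [HasShift C ℤ] [∀ n : ℤ, (shiftFunctor C n).Additive] {S X Y : C}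
    {j : X ⟶ Y} (hj : IsMonic S j) (n : ℤ) : IsMonic (S⟦n⟧) (j⟦n⟧') := fun u hu => by
  obtain ⟨u, rfl⟩ := (shiftFunctor C n).map_surjective u
  rw [← Functor.map_comp, Functor.map_eq_zero_iff] at hu
  rw [hj u hu, Functor.map_zero]

lemma condI_iff {T M B L U V : C} (i : M ⟶ B) (p : B ⟶ L) (iU : U ⟶ M) (iV : V ⟶ L) :
    CondI T i p iU iV ↔ ∃ E : Submodule (End T)ᵐᵒᵖ (T ⟶ B),
      (∀ l : T ⟶ L, (∃ v : T ⟶ V, v ≫ iV = l) ↔ ∃ b ∈ E, b ≫ p = l) ∧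
      ∀ m : T ⟶ M, (∃ u : T ⟶ U, u ≫ iU = m) ↔ m ≫ i ∈ E := by
  refine exists_congr fun E => and_congr ?_ ?_ <;> rw [SetLike.ext_iff] <;> rfl

end Relative

section Add

variable {C : Type u} [Category.{v} C] [Preadditive C] [HasFiniteBiproducts C]

lemma inAdd_biproduct (S : C) (n : ℕ) : InAdd S (⨁ fun _ : Fin n => S) :=
  ⟨n, ⟨Retract.refl _⟩⟩

lemma InAdd.shift [HasShift C ℤ] [∀ n : ℤ, (shiftFunctor C n).Additive] {S P : C}
    (hP : InAdd S P) (n : ℤ) : InAdd (S⟦n⟧) (P⟦n⟧) := by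
  obtain ⟨m, ⟨r⟩⟩ := hP
  exact ⟨m, ⟨(r.map (shiftFunctor C n)).trans
    (Retract.ofIso ((shiftFunctor C n).mapBiproduct fun _ : Fin m => S))⟩⟩

lemma InAdd.isGhost_of_rigid [HasShift C ℤ] [∀ n : ℤ, (shiftFunctor C n).Additive] {S P X : C}
    (hP : InAdd S P) (hS : ∀ f : S ⟶ S⟦(1 : ℤ)⟧, f = 0) (f : X ⟶ P⟦(1 : ℤ)⟧) :
    IsGhost S f := fun t => by
  obtain ⟨n, ⟨r⟩⟩ := hP.shift 1
  have h : (t ≫ f) ≫ r.i = 0 := biproduct.hom_ext _ _ fun m => by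
    rw [zero_comp, hS (((t ≫ f) ≫ r.i) ≫ _)]
  rw [← Category.comp_id (t ≫ f), ← r.retract, ← Category.assoc, h, zero_comp]

lemma InAdd.inIdeal {S P X Y : C} (hP : InAdd S P) (a : X ⟶ P) (b : P ⟶ Y) :
    InIdeal S (a ≫ b) := by
  obtain ⟨n, ⟨r⟩⟩ := hP
  exact ⟨n, a ≫ r.i, r.r ≫ b, by rw [Category.assoc, r.retract_assoc]⟩

lemma IsGhost.of_inAdd {S P X Y : C} {f : X ⟶ Y} (hf : IsGhost S f) (hP : InAdd S P) :
    IsGhost P f := fun t => by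
  obtain ⟨n, ⟨r⟩⟩ := hP
  have h : r.r ≫ t ≫ f = 0 := biproduct.hom_ext' _ _ fun m => by
    rw [← Category.assoc, ← Category.assoc, hf, comp_zero]
  rw [← Category.id_comp (t ≫ f), ← r.retract, Category.assoc, h, comp_zero]

lemma IsMonic.of_inAdd {S P X Y : C} {j : X ⟶ Y} (hj : IsMonic S j) (hP : InAdd S P) :
    IsMonic P j := fun u hu => by
  have hu' : IsGhost S u := hj.isGhost_of_comp fun t => by rw [hu, comp_zero]
  rw [← Category.id_comp u, hu'.of_inAdd hP]

-- `𝒞(S, P)` is a projective `End S`-module.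
lemma InAdd.exists_lift {S P X Y : C} (hP : InAdd S P) (E : Submodule (End S)ᵐᵒᵖ (S ⟶ X))
    (j : X ⟶ Y) (s : P ⟶ Y) (hs : ∀ c : S ⟶ P, ∃ u ∈ E, u ≫ j = c ≫ s) :
    ∃ s' : P ⟶ X, s' ≫ j = s ∧ ∀ c : S ⟶ P, c ≫ s' ∈ E := by
  obtain ⟨n, ⟨r⟩⟩ := hP
  choose u huE hu using fun m : Fin n => hs (biproduct.ι (fun _ => S) m ≫ r.r)
  refine ⟨r.i ≫ biproduct.desc u, ?_, fun c => ?_⟩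
  · have h : biproduct.desc u ≫ j = r.r ≫ s := biproduct.hom_ext' _ _ fun m => by
      rw [biproduct.ι_desc_assoc, hu, Category.assoc]
    rw [Category.assoc, h, r.retract_assoc]
  · have h : c ≫ r.i ≫ biproduct.desc u =
        ∑ m, MulOpposite.op (α := End S) (c ≫ r.i ≫ biproduct.π (fun _ => S) m) • u m := by
      simp only [biproduct.desc_eq, Preadditive.comp_sum]
      exact Finset.sum_congr rfl fun m _ => by
        rw [← Category.assoc, ← Category.assoc, Category.assoc c]
        rfl
    rw [h]
    exact E.sum_mem fun m _ => E.smul_mem _ (huE m)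

end Add

section Desuspension

variable {C : Type u} [Category.{v} C] [HasShift C ℤ]

lemma desusp_injective {L M : C} : Function.Injective (desusp (L := L) (M := M)) :=
  fun _ _ h => (shiftFunctor C (-1 : ℤ)).map_injective ((cancel_mono _).1 h)

lemma desusp_surjective {L M : C} : Function.Surjective (desusp (L := L) (M := M)) := fun e => by
  obtain ⟨a, ha⟩ := (shiftFunctor C (-1 : ℤ)).map_surjective (e ≫ (shiftShiftNeg M (1 : ℤ)).inv)
  exact ⟨a, (congrArg (· ≫ (shiftShiftNeg M (1 : ℤ)).hom) ha).trans
    ((Category.assoc _ _ _).trans ((congrArg (e ≫ ·) (Iso.inv_hom_id _)).trans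
      (Category.comp_id e)))⟩

lemma desusp_precomp {V L M : C} (j : V ⟶ L) (a : L ⟶ M⟦(1 : ℤ)⟧) :
    desusp (j ≫ a) = j⟦(-1 : ℤ)⟧' ≫ desusp a := by
  rw [desusp, desusp, Functor.map_comp, Category.assoc]

lemma desusp_postcomp {L U M : C} (a : L ⟶ U⟦(1 : ℤ)⟧) (j : U ⟶ M) :
    desusp (a ≫ j⟦(1 : ℤ)⟧') = desusp a ≫ j := by
  have h : j⟦(1 : ℤ)⟧'⟦(-1 : ℤ)⟧' ≫ (shiftShiftNeg M (1 : ℤ)).hom =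
      (shiftShiftNeg U (1 : ℤ)).hom ≫ j :=
    (shiftFunctorCompIsoId C (1 : ℤ) (-1) (add_neg_cancel 1)).hom.naturality j
  rw [desusp, desusp, Functor.map_comp, Category.assoc, Category.assoc, h]

lemma desusp_sub [Preadditive C] [∀ n : ℤ, (shiftFunctor C n).Additive] {L M : C}
    (a b : L ⟶ M⟦(1 : ℤ)⟧) : desusp (a - b) = desusp a - desusp b := by
  rw [desusp, desusp, desusp, Functor.map_sub, Preadditive.sub_comp]

end Desuspension

section RigidGenerator

variable {C : Type u} [Category.{v} C] [Preadditive C] [HasZeroObject C] [HasShift C ℤ]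
  [∀ n : ℤ, (shiftFunctor C n).Additive] [Pretriangulated C]

lemma mk_comp_iso_distinguished {X Y Z Z' : C} {f : X ⟶ Y} {g : Y ⟶ Z} {h : Z ⟶ X⟦(1 : ℤ)⟧}
    (hΔ : Triangle.mk f g h ∈ distTriang C) (e : Z ≅ Z') :
    Triangle.mk f (g ≫ e.hom) (e.inv ≫ h) ∈ distTriang C := by
  have h₁ : f ≫ 𝟙 Y = 𝟙 X ≫ f := by rw [Category.comp_id, Category.id_comp]
  have h₂ : (g ≫ e.hom) ≫ e.inv = 𝟙 Y ≫ g := by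
    rw [Category.assoc, e.hom_inv_id, Category.comp_id, Category.id_comp]
  have h₃ : (e.inv ≫ h) ≫ (𝟙 X)⟦(1 : ℤ)⟧' = e.inv ≫ h := by
    rw [CategoryTheory.Functor.map_id, Category.comp_id]
  exact isomorphic_distinguished _ hΔ _
    (Triangle.isoMk _ _ (Iso.refl X) (Iso.refl Y) e.symm h₁ h₂ h₃)

/-- `S` is rigid and generates in one step: `𝒞(S, ΣS) = 0` and `𝒞 = add S ∗ add ΣS`, that is,
every object `X` is the cone of a morphism in `add S`. This is the form in which the cluster-tilting
property enters the triangulated part of the argument. -/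
structure IsRigidGenerator (S : C) : Prop where
  rigid : ∀ f : S ⟶ S⟦(1 : ℤ)⟧, f = 0
  exists_presentation : ∀ X : C, ∃ (P Q : C) (κ : P ⟶ Q) (π : Q ⟶ X) (w : X ⟶ P⟦(1 : ℤ)⟧),
    Triangle.mk κ π w ∈ distTriang C ∧ InAdd S P ∧ InAdd S Q

lemma IsRigidGenerator.shift {S : C} (hS : IsRigidGenerator S) : IsRigidGenerator (S⟦(1 : ℤ)⟧) where
  rigid f := by
    obtain ⟨g, rfl⟩ := (shiftFunctor C (1 : ℤ)).map_surjective f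
    rw [hS.rigid g, Functor.map_zero]
  exists_presentation X := by
    obtain ⟨P, Q, κ, π, w, hw, hP, hQ⟩ := hS.exists_presentation (X⟦(-1 : ℤ)⟧)
    exact ⟨_, _, _, _, _, mk_comp_iso_distinguished (Triangle.shift_distinguished _ hw 1)
      (shiftNegShift X (1 : ℤ)), hP.shift 1, hQ.shift 1⟩

lemma IsGhost.exists_factorization {S : C} (hS : IsRigidGenerator S) {X Y : C} {a : X ⟶ Y}
    (ha : IsGhost S a) :
    ∃ (P : C) (w : X ⟶ P⟦(1 : ℤ)⟧) (g : P⟦(1 : ℤ)⟧ ⟶ Y), InAdd S P ∧ a = w ≫ g := by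
  obtain ⟨P, Q, κ, π, w, hw, hP, hQ⟩ := hS.exists_presentation X
  obtain ⟨g, hg⟩ : ∃ g : P⟦(1 : ℤ)⟧ ⟶ Y, a = w ≫ g :=
    Triangle.yoneda_exact₃ _ hw a (ha.of_inAdd hQ π)
  exact ⟨P, w, g, hP, hg⟩

lemma inIdeal_desusp_iff {S : C} (hS : IsRigidGenerator S) {X Y : C} (a : X ⟶ Y⟦(1 : ℤ)⟧) :
    InIdeal S (desusp a) ↔ IsGhost S a := by
  constructor
  · rintro ⟨n, b, c, h⟩
    obtain ⟨b, rfl⟩ := desusp_surjective b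
    rw [← desusp_postcomp] at h
    rw [desusp_injective h]
    exact ((inAdd_biproduct S n).isGhost_of_rigid hS.rigid b).postcomp _
  · intro h
    obtain ⟨P, w, g, hP, rfl⟩ := h.exists_factorization hS
    obtain ⟨c, rfl⟩ := (shiftFunctor C (1 : ℤ)).map_surjective g
    rw [desusp_postcomp]
    exact hP.inIdeal _ _

section Conditions

variable {T : C} (hT : IsRigidGenerator T) {M B L U V : C} {ε : L ⟶ M⟦(1 : ℤ)⟧} {iU : U ⟶ M}
  {iV : V ⟶ L}
include hT

lemma isFactorization_desusp_iff {e : V ⟶ U⟦(1 : ℤ)⟧} {f : L ⟶ U⟦(1 : ℤ)⟧} :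
    IsFactorization T ε iU iV (desusp e) (desusp f) ↔
      iV ≫ ε = e ≫ iU⟦(1 : ℤ)⟧' ∧ IsGhost T e ∧
        IsGhost (T⟦(1 : ℤ)⟧) (f ≫ iU⟦(1 : ℤ)⟧' - ε) := by
  rw [← inIdeal_desusp_iff hT, ← inIdeal_desusp_iff hT.shift, desusp_sub, desusp_postcomp,
    ← desusp_injective.eq_iff, desusp_precomp, desusp_postcomp]
  exact ⟨fun h => ⟨h.comm, h.e_mem, h.f_mem⟩, fun h => ⟨h.1, h.2.1, h.2.2⟩⟩

lemma condII_iff :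
    CondII T ε iU iV ↔ ∃ (e : V ⟶ U⟦(1 : ℤ)⟧) (f : L ⟶ U⟦(1 : ℤ)⟧),
      iV ≫ ε = e ≫ iU⟦(1 : ℤ)⟧' ∧ IsGhost T e ∧
        IsGhost (T⟦(1 : ℤ)⟧) (f ≫ iU⟦(1 : ℤ)⟧' - ε) := by
  simp only [CondII, desusp_surjective.exists, isFactorization_desusp_iff hT]

lemma condIII_iff :
    CondIII T ε iU iV ↔ ∃ f : L ⟶ U⟦(1 : ℤ)⟧,
      iV ≫ ε = (iV ≫ f) ≫ iU⟦(1 : ℤ)⟧' ∧ IsGhost T (iV ≫ f) ∧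
        IsGhost (T⟦(1 : ℤ)⟧) (f ≫ iU⟦(1 : ℤ)⟧' - ε) := by
  simp only [CondIII, desusp_surjective.exists, isFactorization_desusp_iff hT,
    ← desusp_precomp, desusp_injective.eq_iff]
  rw [exists_comm]
  simp only [exists_eq_right]

end Conditions

lemma IsMonic.exists_isGhost_comp_sub {S : C} (hS : IsRigidGenerator S) {X Y L : C} {j : X ⟶ Y}
    (hj : IsMonic S j) (a : L ⟶ Y) (ha : ∀ c : S ⟶ L, ∃ u : S ⟶ X, u ≫ j = c ≫ a) :
    ∃ f : L ⟶ X, IsGhost S (f ≫ j - a) := by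
  obtain ⟨P, Q, κ, π, w, hw, hP, hQ⟩ := hS.exists_presentation L
  obtain ⟨g, hg, -⟩ := hQ.exists_lift ⊤ j (π ≫ a) fun c => by
    obtain ⟨u, hu⟩ := ha (c ≫ π)
    exact ⟨u, trivial, by rw [hu, Category.assoc]⟩
  have hκπ : κ ≫ π = 0 := comp_distTriang_mor_zero₁₂ _ hw
  have hκg : κ ≫ g = 0 := hj.of_inAdd hP _ (by
    rw [Category.assoc, hg, ← Category.assoc, hκπ, zero_comp])
  obtain ⟨f, rfl⟩ : ∃ f : L ⟶ X, g = π ≫ f := Triangle.yoneda_exact₂ _ hw g hκg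
  refine ⟨f, fun t => ?_⟩
  obtain ⟨c, rfl⟩ : ∃ c : S ⟶ Q, t = c ≫ π :=
    Triangle.coyoneda_exact₃ _ hw t (hP.isGhost_of_rigid hS.rigid w t)
  rw [Category.assoc, Preadditive.comp_sub, ← Category.assoc π, hg, sub_self, comp_zero]

section Triangle

variable {T M B L U V : C} {i : M ⟶ B} {p : B ⟶ L} {ε : L ⟶ M⟦(1 : ℤ)⟧}
  (hΔ : Triangle.mk i p ε ∈ distTriang C) {iU : U ⟶ M} {iV : V ⟶ L}
include hΔ

lemma comp_mor₁_eq_zero_iff {A : C} (m : A ⟶ M) :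
    m ≫ i = 0 ↔ ∃ c : A⟦(1 : ℤ)⟧ ⟶ L, c ≫ ε = m⟦(1 : ℤ)⟧' := by
  rw [← (shiftFunctor C (1 : ℤ)).map_eq_zero_iff, Functor.map_comp]
  constructor
  · intro h
    obtain ⟨c, hc⟩ : ∃ c : A⟦(1 : ℤ)⟧ ⟶ L, m⟦(1 : ℤ)⟧' = c ≫ ε :=
      Triangle.coyoneda_exact₁ _ hΔ _ h
    exact ⟨c, hc.symm⟩
  · rintro ⟨c, hc⟩
    have h : ε ≫ i⟦(1 : ℤ)⟧' = 0 := comp_distTriang_mor_zero₃₁ _ hΔ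
    rw [← hc, Category.assoc, h, comp_zero]

lemma exists_isGhost_comp_eq (hT : IsRigidGenerator T) (E : Submodule (End T)ᵐᵒᵖ (T ⟶ B))
    (hEV : ∀ v : T ⟶ V, ∃ b ∈ E, b ≫ p = v ≫ iV)
    (hEU : ∀ m : T ⟶ M, m ≫ i ∈ E → ∃ u : T ⟶ U, u ≫ iU = m) :
    ∃ e : V ⟶ U⟦(1 : ℤ)⟧, iV ≫ ε = e ≫ iU⟦(1 : ℤ)⟧' ∧ IsGhost T e := by
  obtain ⟨P, Q, κ, π, w, hw, hP, hQ⟩ := hT.exists_presentation V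
  obtain ⟨b, hbp, hbE⟩ := hQ.exists_lift E p (π ≫ iV) fun c => by
    simpa only [Category.assoc] using hEV (c ≫ π)
  obtain ⟨s, hs, hsw⟩ : ∃ s : P ⟶ M, κ ≫ b = s ≫ i ∧ w ≫ s⟦(1 : ℤ)⟧' = iV ≫ ε :=
    complete_distinguished_triangle_morphism₁ _ _ hw hΔ b iV hbp.symm
  obtain ⟨s', hs', -⟩ := hP.exists_lift ⊤ iU s fun c => by
    obtain ⟨u, hu⟩ := hEU (c ≫ s) (by simpa only [Category.assoc, hs] using hbE (c ≫ κ))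
    exact ⟨u, trivial, hu⟩
  refine ⟨w ≫ s'⟦(1 : ℤ)⟧', ?_, (hP.isGhost_of_rigid hT.rigid w).postcomp _⟩
  rw [Category.assoc, ← Functor.map_comp, hs', hsw]

lemma condII_of_condI (hT : IsRigidGenerator T) (hU : IsMonic T iU) (h : CondI T i p iU iV) :
    CondII T ε iU iV := by
  obtain ⟨E, hEV, hEU⟩ := (condI_iff i p iU iV).1 h
  obtain ⟨e, hcomm, he⟩ := exists_isGhost_comp_eq hΔ hT E (fun v => (hEV _).1 ⟨v, rfl⟩)
    fun m => (hEU m).2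
  obtain ⟨f, hf⟩ := (hU.shift 1).exists_isGhost_comp_sub hT.shift ε fun c => by
    obtain ⟨m, hm⟩ := (shiftFunctor C (1 : ℤ)).map_surjective (c ≫ ε)
    have hmi : m ≫ i = 0 := (comp_mor₁_eq_zero_iff hΔ m).2 ⟨c, hm.symm⟩
    obtain ⟨u, rfl⟩ := (hEU m).2 (hmi ▸ E.zero_mem)
    exact ⟨u⟦(1 : ℤ)⟧', by rw [← hm, Functor.map_comp]⟩
  exact (condII_iff hT).2 ⟨e, f, hcomm, he, hf⟩

lemma exists_comp_eq_of_comp_mor₁_eq_zero {f : L ⟶ U⟦(1 : ℤ)⟧}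
    (hf : IsGhost (T⟦(1 : ℤ)⟧) (f ≫ iU⟦(1 : ℤ)⟧' - ε)) {m : T ⟶ M} (hm : m ≫ i = 0) :
    ∃ u : T ⟶ U, u ≫ iU = m := by
  obtain ⟨c, hc⟩ := (comp_mor₁_eq_zero_iff hΔ m).1 hm
  obtain ⟨u, hu⟩ := (shiftFunctor C (1 : ℤ)).map_surjective (c ≫ f)
  refine ⟨u, (shiftFunctor C (1 : ℤ)).map_injective ?_⟩
  rw [Functor.map_comp, hu, ← hc, Category.assoc, ← sub_eq_zero, ← Preadditive.comp_sub, hf]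

-- `E` is the image of `F iW`, for a morphism from the triangle `U ⟶ W ⟶ V ⟶ ΣU` given by `e`
-- to `Δ` with components `iU`, `iW`, `iV`.
lemma condI_of_condII (hT : IsRigidGenerator T) (hV : IsMonic T iV) (h : CondII T ε iU iV) :
    CondI T i p iU iV := by
  obtain ⟨e, f, hcomm, he, hf⟩ := (condII_iff hT).1 h
  obtain ⟨W, j, q, hW⟩ := distinguished_cocone_triangle₂ e
  obtain ⟨iW, hjW, hqW⟩ : ∃ iW : W ⟶ B, j ≫ iW = iU ≫ i ∧ q ≫ iV = iW ≫ p :=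
    complete_distinguished_triangle_morphism₂ _ _ hW hΔ iU iV hcomm.symm
  have hip : i ≫ p = 0 := comp_distTriang_mor_zero₁₂ _ hΔ
  have mem_range (b : T ⟶ B) :
      b ∈ LinearMap.range ((F T).map iW).hom ↔ ∃ x : T ⟶ W, x ≫ iW = b := Iff.rfl
  refine (condI_iff i p iU iV).2 ⟨LinearMap.range ((F T).map iW).hom, fun l => ⟨?_, ?_⟩,
    fun m => ⟨?_, fun hm => ?_⟩⟩
  · rintro ⟨v, rfl⟩
    obtain ⟨x, rfl⟩ : ∃ x : T ⟶ W, v = x ≫ q := Triangle.coyoneda_exact₃ _ hW v (he v)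
    exact ⟨x ≫ iW, ⟨x, rfl⟩, by rw [Category.assoc, Category.assoc, hqW]⟩
  · rintro ⟨b, hb, rfl⟩
    obtain ⟨x, rfl⟩ := (mem_range b).1 hb
    exact ⟨x ≫ q, by rw [Category.assoc, Category.assoc, hqW]⟩
  · rintro ⟨u, rfl⟩
    exact (mem_range _).2 ⟨u ≫ j, by rw [Category.assoc, Category.assoc, hjW]⟩
  · obtain ⟨x, hx⟩ := (mem_range _).1 hm
    have hxq : x ≫ q = 0 := hV _ (by
      rw [Category.assoc, hqW, ← Category.assoc, hx, Category.assoc, hip, comp_zero])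
    obtain ⟨u, rfl⟩ : ∃ u : T ⟶ U, x = u ≫ j := Triangle.coyoneda_exact₂ _ hW x hxq
    have hmu : (m - u ≫ iU) ≫ i = 0 := by
      rw [Preadditive.sub_comp, ← hx, Category.assoc, Category.assoc, hjW, sub_self]
    obtain ⟨u', hu'⟩ := exists_comp_eq_of_comp_mor₁_eq_zero hΔ hf hmu
    exact ⟨u' + u, by rw [Preadditive.add_comp, hu', sub_add_cancel]⟩

end Triangle

end RigidGenerator

section Pairing

variable {k : Type w} [Field k] {C : Type u} [Category.{v} C] [Preadditive C] [Linear k C]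

variable (k) in
/-- The subspace of `𝒞(X, Y)` formed by the `S`-ghosts. -/
def ghosts (S X Y : C) : Submodule k (X ⟶ Y) where
  carrier := {f | IsGhost S f}
  add_mem' ha hb t := by rw [Preadditive.comp_add, ha t, hb t, add_zero]
  zero_mem' _ := comp_zero
  smul_mem' c f hf t := by rw [Linear.comp_smul, hf t, smul_zero]

variable (k) in
lemma exists_add_approximation [HasFiniteBiproducts C] (S X : C)
    [Module.Finite k (S ⟶ X)] :
    ∃ (n : ℕ) (π : (⨁ fun _ : Fin n => S) ⟶ X), ∀ t : S ⟶ X, ∃ c, t = c ≫ π := by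
  let b := Module.finBasis k (S ⟶ X)
  refine ⟨_, biproduct.desc fun m => b m, fun t =>
    ⟨∑ m, b.repr t m • biproduct.ι (fun _ => S) m, ?_⟩⟩
  conv_lhs => rw [← b.sum_repr t]
  simp only [Preadditive.sum_comp, Linear.smul_comp, biproduct.ι_desc]

variable [HasShift C ℤ]

/-- The isomorphisms `φ X Y : 𝒞(X, ΣY) ≃ D 𝒞(Y, ΣX)` are natural in `X` and `Y`; such a family
is a 2-Calabi–Yau structure. -/
def IsNaturalPairing
    (φ : ∀ X Y : C, (X ⟶ Y⟦(1 : ℤ)⟧) ≃ₗ[k] Module.Dual k (Y ⟶ X⟦(1 : ℤ)⟧)) : Prop :=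
  ∀ (X X' Y Y' : C) (f : X' ⟶ X) (g : Y ⟶ Y') (a : X ⟶ Y⟦(1 : ℤ)⟧) (b : Y' ⟶ X'⟦(1 : ℤ)⟧),
    φ X' Y' (f ≫ a ≫ g⟦(1 : ℤ)⟧') b = φ X Y a (g ≫ b ≫ f⟦(1 : ℤ)⟧')

variable {φ : ∀ X Y : C, (X ⟶ Y⟦(1 : ℤ)⟧) ≃ₗ[k] Module.Dual k (Y ⟶ X⟦(1 : ℤ)⟧)}

lemma pairing_leftComp (hφ : IsNaturalPairing φ) {X X' Y : C} (f : X' ⟶ X)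
    (a : X ⟶ Y⟦(1 : ℤ)⟧) (b : Y ⟶ X'⟦(1 : ℤ)⟧) :
    φ X' Y (Linear.leftComp k _ f a) b = φ X Y a (Linear.rightComp k _ (f⟦(1 : ℤ)⟧') b) := by
  have h := hφ X X' Y Y f (𝟙 Y) a b
  rwa [(shiftFunctor C (1 : ℤ)).map_id, Category.comp_id, Category.id_comp] at h

lemma pairing_rightComp (hφ : IsNaturalPairing φ) {X Y Y' : C} (g : Y ⟶ Y')
    (a : X ⟶ Y⟦(1 : ℤ)⟧) (b : Y' ⟶ X⟦(1 : ℤ)⟧) :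
    φ X Y' (Linear.rightComp k _ (g⟦(1 : ℤ)⟧') a) b = φ X Y a (Linear.leftComp k _ g b) := by
  have h := hφ X X Y Y' (𝟙 X) g a b
  rwa [(shiftFunctor C (1 : ℤ)).map_id, Category.comp_id, Category.id_comp] at h

lemma IsTwoCalabiYau.eq_zero (hCY : IsTwoCalabiYau k C) {X Y : C}
    (h : ∀ g : Y ⟶ X⟦(1 : ℤ)⟧, g = 0) (f : X ⟶ Y⟦(1 : ℤ)⟧) : f = 0 := by
  obtain ⟨φ, -⟩ := hCY
  refine (φ X Y).map_eq_zero_iff.1 (LinearMap.ext fun g => ?_)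
  rw [h g, map_zero, map_zero]

lemma IsTwoCalabiYau.finite_hom (hCY : IsTwoCalabiYau k C) (X Y : C) :
    Module.Finite k (X ⟶ Y) := by
  obtain ⟨φ, -⟩ := hCY
  have := finite_of_mutually_dual (φ X (Y⟦(-1 : ℤ)⟧)) (φ (Y⟦(-1 : ℤ)⟧) X)
  exact Module.Finite.equiv (Linear.homCongr k (Iso.refl X) (shiftNegShift Y (1 : ℤ)))

lemma IsTwoCalabiYau.exists_extension (hCY : IsTwoCalabiYau k C) {Q V L : C} {j : V ⟶ L}
    (hj : IsMonic Q (j⟦(1 : ℤ)⟧')) (a : V ⟶ Q⟦(1 : ℤ)⟧) : ∃ b : L ⟶ Q⟦(1 : ℤ)⟧, j ≫ b = a := by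
  obtain ⟨φ, hφ⟩ := hCY
  have hker : LinearMap.ker (Linear.rightComp k Q (j⟦(1 : ℤ)⟧')) = ⊥ := LinearMap.ker_eq_bot'.2 hj
  have hrange : LinearMap.range (Linear.leftComp k (Q⟦(1 : ℤ)⟧) j) = ⊤ := by
    rw [← orthogonal_ker (pairing_leftComp hφ j), hker, orthogonal_bot]
  exact LinearMap.range_eq_top.1 hrange a

end Pairing

section Duality

variable {k : Type w} [Field k] {C : Type u} [Category.{v} C] [Preadditive C] [Linear k C]
  [HasZeroObject C] [HasShift C ℤ] [∀ n : ℤ, (shiftFunctor C n).Additive] [Pretriangulated C]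

lemma IsClusterTilting.isRigidGenerator (hCY : IsTwoCalabiYau k C) {S : C}
    (hS : IsClusterTilting S) : IsRigidGenerator S where
  rigid := hS.rigid
  exists_presentation X := by
    have := hCY.finite_hom S X
    obtain ⟨n, π, hπ⟩ := exists_add_approximation k S X
    obtain ⟨P, κ, w, hw⟩ := distinguished_cocone_triangle₁ π
    have hπw : π ≫ w = 0 := comp_distTriang_mor_zero₂₃ _ hw
    have hghost : IsGhost S w := fun t => by
      obtain ⟨c, rfl⟩ := hπ t
      rw [Category.assoc, hπw, comp_zero]
    have hzero (g : S ⟶ P⟦(1 : ℤ)⟧) : g = 0 := by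
      have hgκ : g ≫ κ⟦(1 : ℤ)⟧' = 0 := by
        rw [← Category.id_comp (g ≫ _), (inAdd_biproduct S n).isGhost_of_rigid hS.rigid]
      obtain ⟨c, rfl⟩ : ∃ c : S ⟶ X, g = c ≫ w := Triangle.coyoneda_exact₁ _ hw g hgκ
      exact hghost c
    exact ⟨P, _, κ, π, w, hw, hS.mem_add P (hCY.eq_zero hzero), inAdd_biproduct S n⟩

section Equivalence

variable {T M B L U V : C} {i : M ⟶ B} {p : B ⟶ L} {ε : L ⟶ M⟦(1 : ℤ)⟧} {iU : U ⟶ M} {iV : V ⟶ L}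

lemma condIII_of_condII (hCY : IsTwoCalabiYau k C) (hT : IsRigidGenerator T) (hU : IsMonic T iU)
    (hV : IsMonic T iV) (h : CondII T ε iU iV) : CondIII T ε iU iV := by
  obtain ⟨e, f, hcomm, he, hf⟩ := (condII_iff hT).1 h
  have hdiff : IsGhost (T⟦(1 : ℤ)⟧) (iV ≫ f - e) := (hU.shift 1).isGhost_of_comp (by
    rw [Preadditive.sub_comp, Category.assoc, ← hcomm, ← Preadditive.comp_sub]
    exact hf.precomp iV)
  obtain ⟨Q, w, g, hQ, hw⟩ := hdiff.exists_factorization hT.shift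
  obtain ⟨w, rfl⟩ := hCY.exists_extension ((hV.shift 1).of_inAdd hQ) w
  have hfe : iV ≫ (f - w ≫ g) = e := by
    rw [Preadditive.comp_sub, ← Category.assoc, ← hw, sub_sub_cancel]
  have hwg : IsGhost (T⟦(1 : ℤ)⟧) (w ≫ g ≫ iU⟦(1 : ℤ)⟧') :=
    (hQ.isGhost_of_rigid hT.shift.rigid w).postcomp _
  refine (condIII_iff hT).2 ⟨f - w ≫ g, ?_, ?_, ?_⟩
  · rw [hfe, hcomm]
  · rwa [hfe]
  · rw [Preadditive.sub_comp, Category.assoc, sub_right_comm]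
    exact (ghosts k _ _ _).sub_mem hf hwg

lemma tfae_condI_condII_condIII (hCY : IsTwoCalabiYau k C) (hT : IsRigidGenerator T)
    (hΔ : Triangle.mk i p ε ∈ distTriang C) (hU : IsMonic T iU) (hV : IsMonic T iV) :
    List.TFAE [CondI T i p iU iV, CondII T ε iU iV, CondIII T ε iU iV] := by
  tfae_have 1 → 2 := condII_of_condI hΔ hT hU
  tfae_have 2 → 3 := condIII_of_condII hCY hT hU hV
  tfae_have 3 → 2 := fun ⟨e, f, h, _⟩ => ⟨e, f, h⟩
  tfae_have 2 → 1 := condI_of_condII hΔ hT hV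
  tfae_finish

end Equivalence

section Dichotomy

lemma orthogonal_ghosts {φ : ∀ X Y : C, (X ⟶ Y⟦(1 : ℤ)⟧) ≃ₗ[k] Module.Dual k (Y ⟶ X⟦(1 : ℤ)⟧)}
    (hφ : IsNaturalPairing φ) {S : C} (hS : IsRigidGenerator S) (X Y : C) :
    orthogonal (φ X Y) (ghosts k S Y (X⟦(1 : ℤ)⟧)) = ghosts k S X (Y⟦(1 : ℤ)⟧) := by
  ext a
  rw [mem_orthogonal]
  constructor
  · intro ha t
    refine (φ S Y).map_eq_zero_iff.1 (LinearMap.ext fun b => ?_)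
    have hb : IsGhost S (b ≫ t⟦(1 : ℤ)⟧') := fun c => by
      rw [← Category.assoc, hS.rigid (c ≫ b), zero_comp]
    exact (pairing_leftComp hφ t a b).trans (ha _ hb)
  · intro ha b hb
    obtain ⟨P, w, g, hP, rfl⟩ := IsGhost.exists_factorization hS hb
    obtain ⟨c, rfl⟩ := (shiftFunctor C (1 : ℤ)).map_surjective g
    have hca : c ≫ a = 0 := IsGhost.of_inAdd ha hP c
    calc φ X Y a (w ≫ c⟦(1 : ℤ)⟧') = φ P Y (c ≫ a) w := (pairing_leftComp hφ c a w).symm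
      _ = 0 := by rw [hca, map_zero, LinearMap.zero_apply]

variable {L M U V : C}

variable (k) in
/-- The subspace of those `ε ∈ 𝒞(L, ΣM)` that satisfy condition (ii), see `condII_iff_mem`. -/
def condIISubspace (T : C) (iU : U ⟶ M) (iV : V ⟶ L) : Submodule k (L ⟶ M⟦(1 : ℤ)⟧) :=
  ((ghosts k T V (U⟦(1 : ℤ)⟧)).map (Linear.rightComp k V (iU⟦(1 : ℤ)⟧'))).comap
      (Linear.leftComp k (M⟦(1 : ℤ)⟧) iV) ⊓
    (LinearMap.range (Linear.rightComp k L (iU⟦(1 : ℤ)⟧')) ⊔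
      ghosts k (T⟦(1 : ℤ)⟧) L (M⟦(1 : ℤ)⟧))

variable (k) in
/-- The subspace of those `ε ∈ 𝒞(L, ΣM)` that satisfy condition (iii), see `condIII_iff_mem`. -/
def condIIISubspace (T : C) (iU : U ⟶ M) (iV : V ⟶ L) : Submodule k (L ⟶ M⟦(1 : ℤ)⟧) :=
  ((ghosts k T V (U⟦(1 : ℤ)⟧)).comap (Linear.leftComp k (U⟦(1 : ℤ)⟧) iV)).map
      (Linear.rightComp k L (iU⟦(1 : ℤ)⟧')) ⊔
    (LinearMap.ker (Linear.leftComp k (M⟦(1 : ℤ)⟧) iV) ⊓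
      ghosts k (T⟦(1 : ℤ)⟧) L (M⟦(1 : ℤ)⟧))

variable {T : C} (hT : IsRigidGenerator T) {iU : U ⟶ M} {iV : V ⟶ L}
include hT

lemma condII_iff_mem {ε : L ⟶ M⟦(1 : ℤ)⟧} : CondII T ε iU iV ↔ ε ∈ condIISubspace k T iU iV := by
  rw [condII_iff hT, condIISubspace, Submodule.mem_inf, LinearMap.range_eq_map, mem_map_sup]
  exact ⟨fun ⟨e, f, hcomm, he, hf⟩ => ⟨⟨e, he, hcomm.symm⟩, f, trivial, hf⟩,
    fun ⟨⟨e, he, hcomm⟩, f, _, hf⟩ => ⟨e, f, hcomm.symm, he, hf⟩⟩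

lemma condIII_iff_mem {ε : L ⟶ M⟦(1 : ℤ)⟧} :
    CondIII T ε iU iV ↔ ε ∈ condIIISubspace k T iU iV := by
  have mem_ker (f : L ⟶ U⟦(1 : ℤ)⟧) :
      f ≫ iU⟦(1 : ℤ)⟧' - ε ∈ LinearMap.ker (Linear.leftComp k (M⟦(1 : ℤ)⟧) iV) ↔
        iV ≫ ε = (iV ≫ f) ≫ iU⟦(1 : ℤ)⟧' := by
    rw [LinearMap.mem_ker, Linear.leftComp_apply, Preadditive.comp_sub, sub_eq_zero,
      Category.assoc, eq_comm]
  rw [condIII_iff hT, condIIISubspace, mem_map_sup]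
  exact ⟨fun ⟨f, hcomm, hf, hg⟩ => ⟨f, hf, (mem_ker f).2 hcomm, hg⟩,
    fun ⟨f, hf, hcomm, hg⟩ => ⟨f, (mem_ker f).1 hcomm, hf, hg⟩⟩

lemma orthogonal_condIIISubspace
    {φ : ∀ X Y : C, (X ⟶ Y⟦(1 : ℤ)⟧) ≃ₗ[k] Module.Dual k (Y ⟶ X⟦(1 : ℤ)⟧)}
    (hφ : IsNaturalPairing φ) (iU : U ⟶ M) (iV : V ⟶ L) :
    orthogonal (φ M L) (condIIISubspace k T iU iV) = condIISubspace k T iV iU := by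
  rw [condIIISubspace, orthogonal_sup, orthogonal_map (pairing_leftComp hφ iU),
    orthogonal_comap (pairing_rightComp hφ iV), orthogonal_ghosts hφ hT, orthogonal_inf,
    orthogonal_ker (pairing_rightComp hφ iV), orthogonal_ghosts hφ hT.shift, condIISubspace]

lemma condIII_iff_not_condII (hCY : IsTwoCalabiYau k C)
    (hdim : Module.finrank k (L ⟶ M⟦(1 : ℤ)⟧) = 1) {ε : L ⟶ M⟦(1 : ℤ)⟧} (hε : ε ≠ 0)
    {ε' : M ⟶ L⟦(1 : ℤ)⟧} (hε' : ε' ≠ 0) (iU : U ⟶ M) (iV : V ⟶ L) :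
    CondIII T ε iU iV ↔ ¬ CondII T ε' iV iU := by
  obtain ⟨φ, hφ⟩ := hCY
  rw [condIII_iff_mem (k := k) hT, condII_iff_mem (k := k) hT,
    ← orthogonal_condIIISubspace hT hφ iU iV, mem_orthogonal_iff_notMem hdim hε' hε, not_not]

end Dichotomy

end Duality

end TwoCY

theorem proposition4p3_general {k : Type w} [Field k]
    {C : Type u} [Category.{v} C] [Preadditive C] [Linear k C] [HasZeroObject C]
    [HasShift C ℤ] [∀ n : ℤ, (shiftFunctor C n).Additive] [Pretriangulated C]
    (hCY : TwoCY.IsTwoCalabiYau k C)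
    (T : C) (hT : TwoCY.IsClusterTilting T)
    {L M B B' : C} (hdim : Module.finrank k (L ⟶ M⟦(1 : ℤ)⟧) = 1)
    (i : M ⟶ B) (p : B ⟶ L) (ε : L ⟶ M⟦(1 : ℤ)⟧)
    (hΔ : Triangle.mk i p ε ∈ distTriang C) (hε : ε ≠ 0)
    (i' : L ⟶ B') (p' : B' ⟶ M) (ε' : M ⟶ L⟦(1 : ℤ)⟧)
    (hΔ' : Triangle.mk i' p' ε' ∈ distTriang C) (hε' : ε' ≠ 0)
    {U V : C} (iU : U ⟶ M) (iV : V ⟶ L)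
    (hU : Mono ((TwoCY.F T).map iU)) (hV : Mono ((TwoCY.F T).map iV)) :
    List.TFAE [TwoCY.CondI T i p iU iV, TwoCY.CondII T ε iU iV, TwoCY.CondIII T ε iU iV] ∧
    List.TFAE [TwoCY.CondI T i' p' iV iU, TwoCY.CondII T ε' iV iU, TwoCY.CondIII T ε' iV iU] ∧
    (TwoCY.CondI T i p iU iV ↔ ¬ TwoCY.CondI T i' p' iV iU) ∧
    (TwoCY.CondII T ε iU iV ↔ ¬ TwoCY.CondII T ε' iV iU) ∧
    (TwoCY.CondIII T ε iU iV ↔ ¬ TwoCY.CondIII T ε' iV iU) := by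
  have hT' := hT.isRigidGenerator hCY
  rw [TwoCY.mono_F_map_iff_isMonic] at hU hV
  have h := TwoCY.tfae_condI_condII_condIII hCY hT' hΔ hU hV
  have h' := TwoCY.tfae_condI_condII_condIII hCY hT' hΔ' hV hU
  have hdich := TwoCY.condIII_iff_not_condII hT' hCY hdim hε hε' iU iV
  refine ⟨h, h', ?_, ?_, ?_⟩
  · exact (h.out 0 2).trans (hdich.trans (not_congr (h'.out 1 0)))
  · exact (h.out 1 2).trans hdich
  · exact hdich.trans (not_congr (h'.out 1 2))

theorem proposition4p3 {k : Type w} [Field k] [IsAlgClosed k]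
    {C : Type u} [Category.{v} C] [Preadditive C] [Linear k C] [HasZeroObject C]
    [HasShift C ℤ] [∀ n : ℤ, (shiftFunctor C n).Additive]
    [∀ n : ℤ, (shiftFunctor C n).Linear k] [Pretriangulated C] [IsTriangulated C]
    [IsIdempotentComplete C]
    (hfin : ∀ X Y : C, Module.Finite k (X ⟶ Y))
    (hCY : TwoCY.IsTwoCalabiYau k C)
    (T : C) (hT : TwoCY.IsClusterTilting T)
    {L M B B' : C} (hdim : Module.finrank k (L ⟶ M⟦(1 : ℤ)⟧) = 1)
    (i : M ⟶ B) (p : B ⟶ L) (ε : L ⟶ M⟦(1 : ℤ)⟧)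
    (hΔ : Triangle.mk i p ε ∈ distTriang C) (hε : ε ≠ 0)
    (i' : L ⟶ B') (p' : B' ⟶ M) (ε' : M ⟶ L⟦(1 : ℤ)⟧)
    (hΔ' : Triangle.mk i' p' ε' ∈ distTriang C) (hε' : ε' ≠ 0)
    {U V : C} (iU : U ⟶ M) (iV : V ⟶ L)
    (hU : Mono ((TwoCY.F T).map iU)) (hV : Mono ((TwoCY.F T).map iV)) :
    List.TFAE [TwoCY.CondI T i p iU iV, TwoCY.CondII T ε iU iV, TwoCY.CondIII T ε iU iV] ∧
    List.TFAE [TwoCY.CondI T i' p' iV iU, TwoCY.CondII T ε' iV iU, TwoCY.CondIII T ε' iV iU] ∧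
    (TwoCY.CondI T i p iU iV ↔ ¬ TwoCY.CondI T i' p' iV iU) ∧
    (TwoCY.CondII T ε iU iV ↔ ¬ TwoCY.CondII T ε' iV iU) ∧
    (TwoCY.CondIII T ε iU iV ↔ ¬ TwoCY.CondIII T ε' iV iU) :=
  proposition4p3_general hCY T hT hdim i p ε hΔ hε i' p' ε' hΔ' hε' iU iV hU hV
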